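/- Let \(\mathbb{Z}_2=\{0,1\}\) be the field with two elements, and let \(\mathrm{Pol}_d\) be the family of functions \(f:\mathbb{Z}_2^n\to\mathbb{Z}_2\) that are given by a polynomial over \(\mathbb{Z}_2\) of degree at most \(d\). For \(\epsilon>0\), a \(q\)-query passive \(\epsilon\)-tester for a family \(\mathcal P\) of functions \(\mathbb{Z}_2^n\to\mathbb{Z}_2\) is a randomized algorithm that is given a subset \(U\subseteq\mathbb{Z}_2^n\) of size \(q\), drawn uniformly at random, makes at most \(q\) queries to an unknown function \(f:\mathbb{Z}_2^n\to\mathbb{Z}_2\), all at points of \(U\), and (over the choice of \(U\) and its own coin tosses) accepts with probability at least \(2/3\) if \(f\in\mathcal P\) and rejects with probability at least \(2/3\) if \(|\{x : f(x)\ne g(x)\}|\ge\epsilon 2^n\) for every \(g\in\mathcal P\). Let \(Q^p_\epsilon(\mathcal P)\) be the minimal \(q\) for which such a tester exists, and let \(n_d=\sum_{i=0}^{d}\binom ni\). Theorem. Fix \(\epsilon\) with \(0<\epsilon<1/2\). Then \(Q^p_\epsilon(\mathrm{Pol}_d)=\Theta(n_d)\) uniformly for \(1\le d\le n^{1/3}\);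 that is, there are constants \(c,C>0\) and \(n_0\), depending only on \(\epsilon\), such that \(c\,n_d\le Q^p_\epsilon(\mathrm{Pol}_d)\le C\,n_d\) for all integers \(n\ge n_0\) and \(1\le d\le n^{1/3}\). Moreover, for every constant \(d\ge 0\), as \(n\to\infty\), \(n_d=\Theta(n^d)\) and \(Q^p_\epsilon(\mathrm{Pol}_d)=\Theta(n^d)\). -/

import Mathlib

open scoped ENNReal Asymptotics

/-- The Boolean cube `ℤ₂ⁿ`. -/
abbrev Cube (n : ℕ) : Type := Fin n → ZMod 2

/-- Boolean functions `ℤ₂ⁿ → ℤ₂`. -/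
abbrev BoolFn (n : ℕ) : Type := Cube n → ZMod 2

/-- A deterministic (adaptive) algorithm making at most `q` queries to an unknown function
`X → ℤ₂`: it either stops with a verdict (`true` = accept, `false` = reject), or queries the
function at a point and continues according to the answer. -/
inductive QueryTree (X : Type) : ℕ → Type
  | verdict {q : ℕ} (b : Bool) : QueryTree X q
  | query {q : ℕ} (x : X) (next : ZMod 2 → QueryTree X q) : QueryTree X (q + 1)

/-- The verdict of the algorithm when the unknown function is `g`. -/
def QueryTree.run {X : Type} : {q : ℕ} → QueryTree X q → (X → ZMod 2) → Bool
  | _, .verdict b, _ => b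
  | _, .query x next, g => (next (g x)).run g

/-- A `u`-sample `q`-query randomized algorithm: for each possible sample `U`, a probability
distribution (its coin tosses) on deterministic algorithms that make at most `q` queries, all of
them at points of `U`. -/
abbrev SampleAlg (n q : ℕ) : Type := (U : Finset (Cube n)) → PMF (QueryTree U q)

/-- The distribution of the verdict of the algorithm `A` on the unknown function `f`, when `U` is
drawn uniformly at random among the subsets of `ℤ₂ⁿ` of size `u`. -/
noncomputable def SampleAlg.outcome {n q : ℕ} (A : SampleAlg n q) (u : ℕ)
    (hu : u ≤ (Finset.univ : Finset (Cube n)).card) (f : BoolFn n) : PMF Bool :=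
  (PMF.uniformOfFinset (Finset.powersetCard u (Finset.univ : Finset (Cube n)))
      (Finset.powersetCard_nonempty.2 hu)).bind
    fun U => (A U).map fun T => T.run fun x : U => f x

/-- `f` is `ε`-far from the property `P`. -/
def IsFar {n : ℕ} (ε : ℝ) (f : BoolFn n) (P : Set (BoolFn n)) : Prop :=
  ∀ g ∈ P, ε * 2 ^ n ≤ (hammingDist f g : ℝ)

/-- `A` is a `u`-sample `q`-query `ε`-tester for `P`. -/
def IsSampleTester {n q : ℕ} (ε : ℝ) (P : Set (BoolFn n)) (u : ℕ) (A : SampleAlg n q) : Prop :=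
  ∃ hu : u ≤ (Finset.univ : Finset (Cube n)).card,
    (∀ f ∈ P, (2 / 3 : ℝ≥0∞) ≤ A.outcome u hu f true) ∧
    (∀ f, IsFar ε f P → (2 / 3 : ℝ≥0∞) ≤ A.outcome u hu f false)

/-- The query complexity of passive testing: the minimal `q` such that a `q`-sample `q`-query
`ε`-tester for `P` exists. -/
noncomputable def passiveQueryComplexity {n : ℕ} (ε : ℝ) (P : Set (BoolFn n)) : ℕ :=
  sInf {q : ℕ | ∃ A : SampleAlg n q, IsSampleTester ε P q A}

/-- The Boolean functions that are given by a polynomial over `ℤ₂` of degree at most `d`. -/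
def Pol (n d : ℕ) : Set (BoolFn n) :=
  {f | ∃ p : MvPolynomial (Fin n) (ZMod 2), p.totalDegree ≤ d ∧ ∀ x, f x = MvPolynomial.eval x p}

/-- The number `∑_{i ≤ d} C(n, i)` of multilinear monomials of degree at most `d` in `n`
variables. -/
def numMonomials (n d : ℕ) : ℕ := ∑ i ∈ Finset.range (d + 1), n.choose i

/-! Upper bound: accept exactly when the sampled values extend to a polynomial of degree at most d.
Members always pass. If f is ε-far, a fixed polynomial agrees with f on the whole sample with
probability at most (1-ε)^q, and there are at most 2^(n_d) polynomials, so a union bound shows that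
q = O(n_d) suffices (`exists_isSampleTester_le`).

Lower bound: on a sample where every function extends to a polynomial of degree at most d, a uniform
polynomial and a uniform function look alike, yet a uniform function is very likely far from all
polynomials. So there is no tester when most samples are interpolating (`not_isSampleTester`).

A sample fails to interpolate only if one point lies in the degree-d closure Z of the set T of the
others. Restricted to Z, the polynomials of degree at most d form a space of dimension at most |T|.
This dimension counts the standard monomials of Z of degree at most d, and all standard monomials of
Z form a down-set of size |Z|. By Kruskal–Katona, a down-set with more than ∑_{i<d} C(n,i) + 2^k
members has at least C(k,d) members of size d. Hence |T| < C(k,d) keeps Z small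
(`card_degreeClosure_le`). With k close to n - n/(4d), C(k,d) is still at least n_d/4, while 2^k/2^n
is small enough for a union bound; d ≤ n^(1/3) enters here. -/

/-! ### Dimension counted by leading vectors -/

open Finset in
/-- In a family of vectors with distinct keys, the vectors outside of the span of those with smaller
keys count the dimension. -/
theorem finrank_span_key_lt {ι K V : Type*} [Fintype ι] [Field K] [AddCommGroup V] [Module K V]
    [FiniteDimensional K V] (v : ι → V) (key : ι → ℕ) (hkey : Function.Injective key) (k : ℕ) :
    Module.finrank K (Submodule.span K (v '' {i | key i < k})) =
      Nat.card {i // key i < k ∧ v i ∉ Submodule.span K (v '' {j | key j < key i})} := by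
  classical
  induction k with
  | zero => simp
  | succ k ih =>
    have hnat : ∀ k : ℕ, Nat.card {i // key i < k ∧ v i ∉ Submodule.span K
        (v '' {j | key j < key i})} = #{i | key i < k ∧ v i ∉ Submodule.span K
        (v '' {j | key j < key i})} := fun k => by
      rw [Nat.card_eq_fintype_card, Fintype.card_subtype]
    rw [hnat] at ih ⊢
    -- Keys are distinct, so passing from k to k + 1 adds at most one vector; the dimension grows
    -- exactly when that vector is new.
    by_cases hk : ∃ i, key i = k ∧ v i ∉ Submodule.span K (v '' {j | key j < key i})
    · obtain ⟨i, rfl, hi⟩ := hk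
      have h1 : {j | key j < key i + 1} = insert i {j | key j < key i} := by
        ext j
        simp only [Set.mem_ofPred_eq, Set.mem_insert_iff, Nat.lt_succ_iff_lt_or_eq, hkey.eq_iff]
        tauto
      have h2 : ({j | key j < key i + 1 ∧ v j ∉ Submodule.span K (v '' {l | key l < key j})} :
          Finset ι) = insert i ({j | key j < key i ∧ v j ∉ Submodule.span K
            (v '' {l | key l < key j})} : Finset ι) := by
        ext j
        simp only [mem_filter, mem_univ, true_and, mem_insert, Nat.lt_succ_iff_lt_or_eq,
          hkey.eq_iff]
        constructor
        · rintro ⟨h | h, h'⟩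
          · exact Or.inr ⟨h, h'⟩
          · exact Or.inl h
        · rintro (rfl | ⟨h, h'⟩)
          · exact ⟨Or.inr rfl, hi⟩
          · exact ⟨Or.inl h, h'⟩
      rw [h1, h2, card_insert_of_notMem (by simp), ← ih, Set.image_insert_eq, Set.insert_eq,
        Submodule.span_union]
      rw [sup_comm]
      exact Submodule.finrank_sup_span_singleton hi
    · have h1 : Submodule.span K (v '' {j | key j < k + 1}) =
          Submodule.span K (v '' {j | key j < k}) := by
        apply le_antisymm
        · rw [Submodule.span_le]
          rintro _ ⟨j, hj, rfl⟩
          rcases Nat.lt_succ_iff_lt_or_eq.1 hj with h | h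
          · exact Submodule.subset_span ⟨j, h, rfl⟩
          · by_contra h'
            exact hk ⟨j, h, by rwa [h]⟩
        · exact Submodule.span_mono (Set.image_mono fun j hj => Nat.lt_succ_of_lt hj)
      rw [h1, ih]
      congr 1
      ext j
      simp only [mem_filter, mem_univ, true_and, Nat.lt_succ_iff_lt_or_eq]
      constructor
      · rintro ⟨h, h'⟩
        exact ⟨Or.inl h, h'⟩
      · rintro ⟨h | h, h'⟩
        · exact ⟨h, h'⟩
        · exact absurd ⟨j, h, h'⟩ hk

/-! ### Polynomials as combinations of multilinear monomials -/

/-- The multilinear monomial of a set of variables. -/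
def monomialFn {n : ℕ} (S : Finset (Fin n)) : BoolFn n := fun x => ∏ i ∈ S, x i

/-- The space spanned by the multilinear monomials of degree at most `d`. -/
def polSubmodule (n d : ℕ) : Submodule (ZMod 2) (BoolFn n) :=
  Submodule.span (ZMod 2) (monomialFn '' {S | S.card ≤ d})

theorem zmod_two_mul_self (a : ZMod 2) : a * a = a := by revert a; decide

theorem zmod_two_pow (a : ZMod 2) {e : ℕ} (he : e ≠ 0) : a ^ e = a := by
  induction e with
  | zero => exact absurd rfl he
  | succ e ih =>
    rcases eq_or_ne e 0 with rfl | h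
    · simp
    · rw [pow_succ, ih h, zmod_two_mul_self]

theorem monomialFn_insert {n : ℕ} (a : Fin n) (S : Finset (Fin n)) (x : Cube n) :
    monomialFn (insert a S) x = x a * monomialFn S x := by
  by_cases h : a ∈ S
  · rw [Finset.insert_eq_of_mem h]
    unfold monomialFn
    rw [← Finset.mul_prod_erase S _ h, ← mul_assoc, zmod_two_mul_self]
  · unfold monomialFn
    rw [Finset.prod_insert h]

/-- Over ℤ₂, a ^ e = a for e ≠ 0, so an exponent vector may be replaced by its support, which does
not raise the degree. -/
theorem eval_mem_polSubmodule {n d : ℕ} (p : MvPolynomial (Fin n) (ZMod 2))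
    (hp : p.totalDegree ≤ d) : (fun x => MvPolynomial.eval x p) ∈ polSubmodule n d := by
  have h : (fun x => MvPolynomial.eval x p) =
      ∑ e ∈ p.support, p.coeff e • monomialFn e.support := by
    funext x
    rw [MvPolynomial.eval_eq, Finset.sum_apply]
    refine Finset.sum_congr rfl fun e _ => ?_
    simp only [Pi.smul_apply, smul_eq_mul, monomialFn]
    congr 1
    exact Finset.prod_congr rfl fun i hi => zmod_two_pow _ (Finsupp.mem_support_iff.1 hi)
  rw [h]
  refine Submodule.sum_mem _ fun e he => Submodule.smul_mem _ _ (Submodule.subset_span ⟨_, ?_, rfl⟩)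
  refine le_trans ?_ ((MvPolynomial.le_totalDegree he).trans hp)
  change e.support.card ≤ _
  rw [Finset.card_eq_sum_ones]
  exact Finset.sum_le_sum fun i hi => Nat.one_le_iff_ne_zero.2 (Finsupp.mem_support_iff.1 hi)

theorem mem_Pol_iff {n d : ℕ} {f : BoolFn n} : f ∈ Pol n d ↔ f ∈ polSubmodule n d := by
  constructor
  · rintro ⟨p, hp, hf⟩
    rw [show f = fun x => MvPolynomial.eval x p from funext hf]
    exact eval_mem_polSubmodule p hp
  · intro hf
    induction hf using Submodule.span_induction with
    | mem f hf =>
      obtain ⟨S, hS, rfl⟩ := hf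
      refine ⟨∏ i ∈ S, MvPolynomial.X i, ?_, fun x => by simp [monomialFn]⟩
      refine (MvPolynomial.totalDegree_finsetProd _ _).trans ?_
      simpa using hS
    | zero => exact ⟨0, by simp, by simp⟩
    | add f g _ _ hf hg =>
      obtain ⟨p, hp, hf⟩ := hf
      obtain ⟨r, hr, hg⟩ := hg
      exact ⟨p + r, (MvPolynomial.totalDegree_add _ _).trans (max_le hp hr), fun x => by
        simp [hf, hg]⟩
    | smul a f _ hf =>
      obtain ⟨p, hp, hf⟩ := hf
      exact ⟨a • p, (MvPolynomial.totalDegree_smul_le _ _).trans hp, fun x => by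
        simp [hf, MvPolynomial.smul_eval]⟩

theorem span_range_monomialFn (n : ℕ) :
    Submodule.span (ZMod 2) (Set.range (monomialFn (n := n))) = ⊤ := by
  rw [eq_top_iff]
  intro f _
  have h := MvPolynomial.map_restrict_dom_evalₗ (ZMod 2) (Fin n)
  have hf : f ∈ (MvPolynomial.restrictDegree (Fin n) (ZMod 2) (Fintype.card (ZMod 2) - 1)).map
    (MvPolynomial.evalₗ (ZMod 2) (Fin n)) := by rw [h]; trivial
  obtain ⟨p, -, rfl⟩ := hf
  exact Submodule.span_mono (Set.image_subset_range _ _) (eval_mem_polSubmodule p le_rfl)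

open Finset in
theorem card_filter_card_le (n d : ℕ) :
    #{S : Finset (Fin n) | #S ≤ d} = numMonomials n d := by
  classical
  have : ({S : Finset (Fin n) | #S ≤ d} : Finset (Finset (Fin n))) =
      (range (d + 1)).biUnion fun i => powersetCard i univ := by
    ext S; simp
  rw [this, card_biUnion]
  · simp [numMonomials]
  · intro i _ j _ hij
    exact pairwise_disjoint_powersetCard _ hij

theorem finrank_polSubmodule_le (n d : ℕ) :
    Module.finrank (ZMod 2) (polSubmodule n d) ≤ numMonomials n d := by
  classical
  have h := finrank_span_finset_le_card (R := ZMod 2)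
    (({S : Finset (Fin n) | S.card ≤ d} : Finset _).image monomialFn)
  rw [← card_filter_card_le]
  refine le_trans ?_ (h.trans Finset.card_image_le)
  simp only [Finset.coe_image, Finset.coe_filter, Finset.mem_univ, true_and]
  exact le_rfl

theorem card_polSubmodule_le (n d : ℕ) :
    Nat.card (polSubmodule n d) ≤ 2 ^ numMonomials n d := by
  rw [Module.natCard_eq_pow_finrank (K := ZMod 2), Nat.card_zmod]
  exact Nat.pow_le_pow_right (by norm_num) (finrank_polSubmodule_le n d)

/-! ### Degree order and standard monomials -/

/-- An additive encoding of sets of variables that sorts by degree first. -/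
def degreeKey {n : ℕ} (S : Finset (Fin n)) : ℕ := ∑ i ∈ S, (2 ^ n + 2 ^ (i : ℕ))

/-- Keeps the binary code of a set below the weight 2^n of one unit of cardinality, so that
`degreeKey` compares sizes first. -/
theorem sum_two_pow_lt {n : ℕ} (S : Finset (Fin n)) : ∑ i ∈ S, 2 ^ (i : ℕ) < 2 ^ n := by
  have h := Nat.geomSum_lt (m := 2) (n := n) (s := S.map Fin.valEmbedding) le_rfl (by simp)
  simpa using h

theorem degreeKey_eq {n : ℕ} (S : Finset (Fin n)) :
    degreeKey S = S.card * 2 ^ n + ∑ i ∈ S, 2 ^ (i : ℕ) := by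
  simp [degreeKey, Finset.sum_add_distrib]

theorem degreeKey_lt_iff {n d : ℕ} (S : Finset (Fin n)) :
    degreeKey S < (d + 1) * 2 ^ n ↔ S.card ≤ d := by
  rw [degreeKey_eq]
  have h := sum_two_pow_lt S
  constructor
  · intro h'
    by_contra hd
    have : (d + 1) * 2 ^ n ≤ S.card * 2 ^ n := Nat.mul_le_mul_right _ (by omega)
    omega
  · intro hd
    have : S.card * 2 ^ n ≤ d * 2 ^ n := Nat.mul_le_mul_right _ hd
    rw [add_mul]
    omega

theorem degreeKey_injective (n : ℕ) : Function.Injective (degreeKey (n := n)) := by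
  intro S T h
  have hc : S.card = T.card := by
    apply le_antisymm
    · rw [← degreeKey_lt_iff, h, degreeKey_lt_iff]
    · rw [← degreeKey_lt_iff, ← h, degreeKey_lt_iff]
  rw [degreeKey_eq, degreeKey_eq, hc] at h
  have h' : ∑ i ∈ S.map Fin.valEmbedding, 2 ^ i = ∑ i ∈ T.map Fin.valEmbedding, 2 ^ i := by
    simpa using h
  exact Finset.map_injective _ (Finset.geomSum_injective le_rfl h')

/-- Additivity makes this a monomial order. If `a ∈ T`, idempotence leaves T unchanged, which only
helps. -/
theorem degreeKey_insert_lt {n : ℕ} {S T : Finset (Fin n)} {a : Fin n} (h : degreeKey T < degreeKey S)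
    (ha : a ∉ S) : degreeKey (insert a T) < degreeKey (insert a S) := by
  have h1 : degreeKey (insert a S) = (2 ^ n + 2 ^ (a : ℕ)) + degreeKey S := by
    simp [degreeKey, Finset.sum_insert ha]
  rw [h1]
  by_cases haT : a ∈ T
  · rw [Finset.insert_eq_of_mem haT]
    exact h.trans_le (Nat.le_add_left _ _)
  · have h2 : degreeKey (insert a T) = (2 ^ n + 2 ^ (a : ℕ)) + degreeKey T := by
      simp [degreeKey, Finset.sum_insert haT]
    omega

open Finset in
/-- The standard monomials of a set of points. -/
theorem exists_standard_monomials {n : ℕ} (Z : Set (Cube n)) :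
    ∃ D : Finset (Finset (Fin n)), (∀ S ∈ D, ∀ T ⊆ S, T ∈ D) ∧ Nat.card Z ≤ #D ∧
      ∀ d, #{S ∈ D | #S ≤ d} ≤ Module.finrank (ZMod 2)
        ((polSubmodule n d).map (LinearMap.funLeft (ZMod 2) (ZMod 2) (Subtype.val : Z → Cube n))) := by
  classical
  set res := LinearMap.funLeft (ZMod 2) (ZMod 2) (Subtype.val : Z → Cube n) with hres
  set v : Finset (Fin n) → (Z → ZMod 2) := fun S => res (monomialFn S) with hv
  have key := finrank_span_key_lt (K := ZMod 2) v degreeKey (degreeKey_injective n)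
  set P : Finset (Fin n) → Prop := fun S =>
    v S ∉ Submodule.span (ZMod 2) (v '' {j | degreeKey j < degreeKey S}) with hP
  have hcard : ∀ d, #{S ∈ ({S | P S} : Finset (Finset (Fin n))) | #S ≤ d} =
      Module.finrank (ZMod 2) ((polSubmodule n d).map res) := by
    intro d
    have h := key ((d + 1) * 2 ^ n)
    have h0 : {i : Finset (Fin n) | degreeKey i < (d + 1) * 2 ^ n} = {S | #S ≤ d} :=
      Set.ext fun S => degreeKey_lt_iff S
    rw [h0] at h
    simp only [degreeKey_lt_iff] at h
    rw [Nat.card_eq_fintype_card, Fintype.card_subtype] at h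
    rw [filter_filter]
    have h2 : (polSubmodule n d).map res = Submodule.span (ZMod 2) (v '' {S | #S ≤ d}) := by
      rw [polSubmodule, Submodule.map_span, Set.image_image]
    rw [h2, h]
    congr 1
    ext S
    simp [hP, and_comm]
  refine ⟨({S | P S} : Finset (Finset (Fin n))), ?_, ?_, fun d => (hcard d).le⟩
  -- If the monomial of S reduces on Z to smaller ones, multiplying that relation by x_a reduces the
  -- monomial of `insert a S`.
  · have step : ∀ S a, a ∉ S → P (insert a S) → P S := by
      intro S a ha h hS
      apply h
      set mulA : (Z → ZMod 2) →ₗ[ZMod 2] (Z → ZMod 2) :=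
        LinearMap.mulLeft (ZMod 2) (fun z : Z => z.1 a) with hm
      have hmv : ∀ T, mulA (v T) = v (insert a T) := by
        intro T
        funext z
        simp [hm, hv, hres, LinearMap.funLeft_apply, monomialFn_insert]
      have h1 := Submodule.mem_map_of_mem (f := mulA) hS
      rw [hmv, Submodule.map_span, Set.image_image] at h1
      refine Submodule.span_mono ?_ h1
      rintro _ ⟨T, hT, rfl⟩
      exact ⟨insert a T, degreeKey_insert_lt hT ha, (hmv T).symm⟩
    have hall : ∀ R T : Finset (Fin n), P (T ∪ R) → P T := by
      intro R
      induction R using Finset.induction_on with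
      | empty => intro T; simp
      | insert a R _ ih =>
        intro T h
        rw [union_insert] at h
        by_cases ha : a ∈ T ∪ R
        · rw [insert_eq_of_mem ha] at h
          exact ih T h
        · exact ih T (step _ a ha h)
    intro S hS T hT
    simp only [mem_filter, mem_univ, true_and] at hS ⊢
    apply hall S T
    rwa [union_eq_right.2 hT]
  -- Every function has degree at most n, so at level n the dimension is that of all functions on Z.
  · have h1 := hcard n
    rw [filter_true_of_mem fun S _ => (card_le_univ S).trans (by simp)] at h1
    rw [h1]
    have h2 : polSubmodule n n = ⊤ := by
      rw [← span_range_monomialFn, polSubmodule]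
      congr 1
      rw [← Set.image_univ]
      congr 1
      ext S
      simpa using (card_le_univ S)
    have h3 : LinearMap.range res = ⊤ :=
      LinearMap.range_eq_top.2 (LinearMap.funLeft_surjective_of_injective _ _ _
        Subtype.val_injective)
    rw [h2, Submodule.map_top, h3, finrank_top, Module.finrank_fintype_fun_eq_card,
      Nat.card_eq_fintype_card]

/-! ### Levels of large down-sets (Kruskal–Katona) -/

open Finset in
/-- A large down-set has many elements on a low level. -/
theorem choose_le_card_level {n d k : ℕ} {D : Finset (Finset (Fin n))}
    (hdown : ∀ S ∈ D, ∀ T ⊆ S, T ∈ D) (hkn : k ≤ n)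
    (hD : ∑ i ∈ range d, n.choose i + 2 ^ k < #D) : k.choose d ≤ #{S ∈ D | #S = d} := by
  classical
  have kk : ∀ r k, d ≤ r → r ≤ k → k ≤ n → k.choose r ≤ #{S ∈ D | #S = r} →
      k.choose d ≤ #{S ∈ D | #S = d} := by
    intro r k hdr hrk hkn h
    have h1 := kruskal_katona_lovasz_form (i := r - d) (r := r) (k := k)
      (𝒜 := {S ∈ D | #S = r}) (Nat.sub_le _ _) hrk hkn
      (by intro S hS; simp at hS; exact hS.2) h
    rw [Nat.sub_sub_self hdr] at h1
    refine h1.trans (card_le_card ?_)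
    intro T hT
    rw [mem_shadow_iterate_iff_exists_sdiff] at hT
    obtain ⟨S, hS, hTS, hcard⟩ := hT
    simp only [mem_filter] at hS ⊢
    refine ⟨hdown S hS.1 T hTS, ?_⟩
    rw [card_sdiff_of_subset hTS] at hcard
    have := card_le_card hTS
    omega
  by_contra! hlt
  have hlev : ∀ r, d ≤ r → #{S ∈ D | #S = r} ≤ k.choose r := by
    intro r hr
    by_contra! h
    rcases le_or_gt r k with hrk | hrk
    · exact absurd (kk r k hr hrk hkn h.le) (by omega)
    -- Here C(k, r) = 0, but a single r-set in D already brings C(r, d) ≥ C(k, d) subsets of size d.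
    · have hr' : r ≤ n := by
        obtain ⟨S, hS⟩ := card_pos.1 (Nat.zero_lt_of_lt h)
        simp only [mem_filter] at hS
        rw [← hS.2]
        exact (card_le_univ S).trans (by simp)
      have h1 := kk r r hr le_rfl hr' (by rw [Nat.choose_self]; omega)
      have := Nat.choose_le_choose d hrk.le
      omega
  have hsum : #D = ∑ i ∈ range (n + 1), #{S ∈ D | #S = i} := by
    apply card_eq_sum_card_fiberwise
    intro S _
    simpa [Nat.lt_succ_iff] using (card_le_univ S).trans (by simp)
  have hbound : ∀ i, #{S ∈ D | #S = i} ≤ (if i < d then n.choose i else 0) + k.choose i := by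
    intro i
    by_cases hi : i < d
    · rw [if_pos hi]
      have : #{S ∈ D | #S = i} ≤ #(powersetCard i (univ : Finset (Fin n))) :=
        card_le_card fun S hS => by simp only [mem_filter] at hS; simp [hS.2]
      rw [card_powersetCard, card_univ, Fintype.card_fin] at this
      omega
    · rw [if_neg hi]
      have := hlev i (by omega)
      omega
  have h1 := sum_le_sum fun i (_ : i ∈ range (n + 1)) => hbound i
  rw [← hsum, sum_add_distrib] at h1
  have h2 : ∑ i ∈ range (n + 1), k.choose i = 2 ^ k := by
    rw [← Nat.sum_range_choose k]
    symm
    apply sum_subset (by intro i; simp; omega)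
    intro i _ hi
    exact Nat.choose_eq_zero_of_lt (by simpa using hi)
  have h3 : ∑ i ∈ range (n + 1), (if i < d then n.choose i else 0) ≤ ∑ i ∈ range d, n.choose i := by
    rw [← sum_filter]
    exact sum_le_sum_of_subset fun i hi => by simp at hi ⊢; exact hi.2
  omega

/-! ### Degree-d closure -/

/-- The points on which every polynomial of degree at most `d` vanishes that vanishes on `T`. -/
def degreeClosure {n : ℕ} (d : ℕ) (T : Set (Cube n)) : Set (Cube n) :=
  {x | ∀ p ∈ polSubmodule n d, (∀ y ∈ T, p y = 0) → p x = 0}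

/-- A polynomial vanishing on T vanishes on the closure, so restriction to the closure factors
through restriction to T. -/
theorem finrank_map_degreeClosure_le {n : ℕ} (d : ℕ) (T : Finset (Cube n)) :
    Module.finrank (ZMod 2) ((polSubmodule n d).map (LinearMap.funLeft (ZMod 2) (ZMod 2)
      (Subtype.val : degreeClosure d (T : Set (Cube n)) → Cube n))) ≤ T.card := by
  classical
  set resT := LinearMap.funLeft (ZMod 2) (ZMod 2) (Subtype.val : T → Cube n)
  set resZ := LinearMap.funLeft (ZMod 2) (ZMod 2)
    (Subtype.val : degreeClosure d (T : Set (Cube n)) → Cube n)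
  set g := resZ.domRestrict (polSubmodule n d)
  set h := resT.domRestrict (polSubmodule n d)
  have h1 : (polSubmodule n d).map resZ = LinearMap.range g := (LinearMap.range_domRestrict _ _).symm
  have hker : LinearMap.ker h ≤ LinearMap.ker g := by
    intro p hp
    rw [LinearMap.mem_ker] at hp ⊢
    funext z
    exact z.2 p.1 p.2 fun y hy => congrFun hp ⟨y, hy⟩
  have hg := LinearMap.finrank_range_add_finrank_ker g
  have hh := LinearMap.finrank_range_add_finrank_ker h
  have h2 := Submodule.finrank_mono hker
  have h3 : Module.finrank (ZMod 2) (LinearMap.range h) ≤ T.card := by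
    refine (Submodule.finrank_le _).trans ?_
    simp
  rw [h1]
  omega

theorem card_degreeClosure_le {n d k : ℕ} (T : Finset (Cube n)) (hkn : k ≤ n)
    (hT : T.card < k.choose d) :
    Nat.card (degreeClosure d (T : Set (Cube n))) ≤
      ∑ i ∈ Finset.range d, n.choose i + 2 ^ k := by
  obtain ⟨D, hdown, hZ, hd⟩ := exists_standard_monomials (degreeClosure d (T : Set (Cube n)))
  by_contra! h
  have h1 := choose_le_card_level hdown hkn (h.trans_le hZ)
  have h2 := (hd d).trans (finrank_map_degreeClosure_le d T)
  have h3 : (D.filter fun S => S.card = d).card ≤ (D.filter fun S => S.card ≤ d).card :=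
    Finset.card_le_card (Finset.monotone_filter_right _ fun S _ h => h.le)
  omega

/-! ### Interpolating samples -/

/-- Every function on `U` is the restriction of a polynomial of degree at most `d`. -/
def IsInterpolating {n : ℕ} (d : ℕ) (U : Finset (Cube n)) : Prop :=
  ∀ x ∈ U, ∃ p ∈ polSubmodule n d, p x = 1 ∧ ∀ y ∈ U, y ≠ x → p y = 0

theorem IsInterpolating.exists_eq {n d : ℕ} {U : Finset (Cube n)} (hU : IsInterpolating d U)
    (h : U → ZMod 2) : ∃ p ∈ polSubmodule n d, ∀ x : U, p x = h x := by
  classical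
  choose p hp hp1 hp0 using fun x : U => hU x x.2
  refine ⟨∑ x : U, h x • p x, Submodule.sum_mem _ fun x _ => Submodule.smul_mem _ _ (hp x), ?_⟩
  intro y
  rw [Finset.sum_apply, Finset.sum_eq_single y]
  · simp [hp1]
  · intro x _ hxy
    simp [hp0 x y y.2 (fun h => hxy (Subtype.ext h.symm))]
  · simp

theorem not_isInterpolating {n d : ℕ} {U : Finset (Cube n)} (hU : ¬ IsInterpolating d U) :
    ∃ x ∈ U, x ∈ degreeClosure d ((U.erase x : Finset (Cube n)) : Set (Cube n)) := by
  unfold IsInterpolating at hU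
  push Not at hU
  obtain ⟨x, hx, h⟩ := hU
  refine ⟨x, hx, fun p hp h0 => ?_⟩
  by_contra hne
  have h1 : p x = 1 := by
    revert hne
    generalize p x = a
    revert a
    decide
  obtain ⟨y, hy, hyx, hpy⟩ := h p hp h1
  exact hpy (h0 y (by simp [hy, hyx]))

-- Union bound: a failing sample is some T of size q with one point of its closure added.
open Finset in
open scoped Classical in
theorem card_not_isInterpolating_le {n d q M : ℕ}
    (hM : ∀ T : Finset (Cube n), #T = q → Nat.card (degreeClosure d (T : Set (Cube n))) ≤ M) :
    #{U ∈ powersetCard (q + 1) (univ : Finset (Cube n)) | ¬ IsInterpolating d U} ≤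
      (2 ^ n).choose q * M := by
  have hsub : ({U ∈ powersetCard (q + 1) (univ : Finset (Cube n)) | ¬ IsInterpolating d U}) ⊆
      (powersetCard q (univ : Finset (Cube n))).biUnion fun T =>
        ({x | x ∈ degreeClosure d (T : Set (Cube n))} : Finset (Cube n)).image
          fun x => insert x T := by
    intro U hU
    simp only [mem_filter, mem_powersetCard_univ] at hU
    obtain ⟨x, hx, hcl⟩ := not_isInterpolating hU.2
    rw [mem_biUnion]
    refine ⟨U.erase x, ?_, ?_⟩
    · rw [mem_powersetCard_univ, card_erase_of_mem hx, hU.1, Nat.add_sub_cancel]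
    · exact mem_image.2 ⟨x, by simpa using hcl, insert_erase hx⟩
  refine (card_le_card hsub).trans (card_biUnion_le.trans ?_)
  have : (2 ^ n).choose q = #(powersetCard q (univ : Finset (Cube n))) := by simp
  rw [this, ← smul_eq_mul]
  refine sum_le_card_nsmul _ _ _ fun T hT => card_image_le.trans ?_
  refine le_of_eq_of_le ?_ (hM T (mem_powersetCard_univ.1 hT))
  rw [Nat.card_eq_fintype_card, ← Fintype.card_subtype]

/-! ### Indistinguishability on interpolating samples -/

theorem sum_comp_surjective {G H : Type*} [AddGroup G] [AddGroup H] [Fintype G] [Fintype H]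
    (φ : G →+ H) (hφ : Function.Surjective φ) (F : H → ℝ) :
    (∑ g, F (φ g)) * Fintype.card H = Fintype.card G * ∑ h, F h := by
  classical
  have hfib : ∀ h, (Finset.univ.filter fun g => φ g = h).card =
      (Finset.univ.filter fun g => φ g = 0).card := fun h =>
    AddMonoidHom.card_fiber_eq_of_mem_range φ (hφ h) (hφ 0)
  have h1 : ∑ g, F (φ g) = (Finset.univ.filter fun g => φ g = 0).card * ∑ h, F h := by
    rw [← Finset.sum_fiberwise Finset.univ φ, Finset.mul_sum]
    refine Finset.sum_congr rfl fun h _ => ?_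
    rw [Finset.sum_congr rfl (g := fun _ => F h) (by
      intro g hg; simp only [Finset.mem_filter] at hg; rw [hg.2]), Finset.sum_const, hfib,
      nsmul_eq_mul]
  have h2 : Fintype.card G = Fintype.card H * (Finset.univ.filter fun g => φ g = 0).card := by
    rw [← Finset.card_univ, Finset.card_eq_sum_card_fiberwise (f := φ) (t := Finset.univ)
      (fun _ _ => Finset.mem_univ _), Finset.sum_congr rfl fun h _ => hfib h]
    simp
  rw [h1, h2]
  push_cast
  ring

/-- Restriction to U is a surjective homomorphism from both spaces, so each uniform distribution is
pushed to the uniform one on `U → ZMod 2`. -/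
theorem IsInterpolating.sum_restrict {n d : ℕ} {U : Finset (Cube n)} (hU : IsInterpolating d U)
    [Fintype (polSubmodule n d)] (F : (U → ZMod 2) → ℝ) :
    Fintype.card (BoolFn n) * ∑ f : polSubmodule n d, F (fun x => f.1 x) =
      Fintype.card (polSubmodule n d) * ∑ f : BoolFn n, F (fun x => f x) := by
  set res := LinearMap.funLeft (ZMod 2) (ZMod 2) (Subtype.val : U → Cube n) with hres
  have hsurj : Function.Surjective res :=
    LinearMap.funLeft_surjective_of_injective _ _ _ Subtype.val_injective
  have h1 := sum_comp_surjective res.toAddMonoidHom hsurj F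
  have h2 := sum_comp_surjective (res.domRestrict (polSubmodule n d)).toAddMonoidHom (by
    intro h
    obtain ⟨p, hp, hph⟩ := hU.exists_eq h
    exact ⟨⟨p, hp⟩, funext hph⟩) F
  have hpos : (0 : ℝ) < Fintype.card (U → ZMod 2) := by exact_mod_cast Fintype.card_pos
  have h1' : (∑ f : BoolFn n, F (fun x => f x)) * Fintype.card (U → ZMod 2) =
    Fintype.card (BoolFn n) * ∑ h, F h := h1
  have h2' : (∑ f : polSubmodule n d, F (fun x => f.1 x)) * Fintype.card (U → ZMod 2) =
    Fintype.card (polSubmodule n d) * ∑ h, F h := h2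
  apply mul_right_cancel₀ hpos.ne'
  rw [mul_assoc, h2', mul_assoc, h1']
  ring

/-- The probability that the algorithm gives the verdict `b` on the sample `U` when the restriction
of the unknown function to `U` is `h`. -/
noncomputable def SampleAlg.verdictProb {n q : ℕ} (A : SampleAlg n q) (U : Finset (Cube n))
    (h : U → ZMod 2) (b : Bool) : ℝ :=
  (((A U).map fun T => T.run h) b).toReal

theorem SampleAlg.verdictProb_nonneg {n q : ℕ} (A : SampleAlg n q) (U : Finset (Cube n))
    (h : U → ZMod 2) (b : Bool) : 0 ≤ A.verdictProb U h b := ENNReal.toReal_nonneg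

theorem SampleAlg.verdictProb_add {n q : ℕ} (A : SampleAlg n q) (U : Finset (Cube n))
    (h : U → ZMod 2) : A.verdictProb U h true + A.verdictProb U h false = 1 := by
  unfold verdictProb
  rw [← ENNReal.toReal_add (PMF.apply_ne_top _ _) (PMF.apply_ne_top _ _)]
  have := PMF.tsum_coe ((A U).map fun T => T.run h)
  rw [tsum_fintype, Fintype.sum_bool] at this
  rw [this, ENNReal.toReal_one]

theorem SampleAlg.toReal_outcome {n q u : ℕ} (A : SampleAlg n q)
    (hu : u ≤ (Finset.univ : Finset (Cube n)).card) (f : BoolFn n) (b : Bool) :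
    (A.outcome u hu f b).toReal * ((2 ^ n).choose u : ℕ) =
      ∑ U ∈ Finset.powersetCard u Finset.univ, A.verdictProb U (fun x => f x) b := by
  classical
  have hcard : (Finset.powersetCard u (Finset.univ : Finset (Cube n))).card = (2 ^ n).choose u := by
    simp
  have hpos : ((2 ^ n).choose u : ℝ) ≠ 0 := by
    have : 0 < (2 ^ n).choose u := Nat.choose_pos (by simpa using hu)
    positivity
  unfold outcome
  rw [PMF.bind_apply, tsum_fintype, ENNReal.toReal_sum (fun U _ =>
    ENNReal.mul_ne_top (PMF.apply_ne_top _ _) (PMF.apply_ne_top _ _)), Finset.sum_mul,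
    ← Finset.sum_subset (Finset.subset_univ (Finset.powersetCard u Finset.univ))]
  · refine Finset.sum_congr rfl fun U hU => ?_
    rw [PMF.uniformOfFinset_apply_of_mem _ hU, hcard, ENNReal.toReal_mul, ENNReal.toReal_inv,
      ENNReal.toReal_natCast]
    unfold verdictProb
    field_simp
  · intro U _ hU
    rw [PMF.uniformOfFinset_apply_of_notMem _ hU]
    simp

theorem two_thirds_le_toReal {x : ℝ≥0∞} (hx : x ≠ ⊤) : 2 / 3 ≤ x ↔ 2 / 3 ≤ x.toReal := by
  have h : (2 / 3 : ℝ≥0∞) = ENNReal.ofReal (2 / 3) := by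
    rw [ENNReal.ofReal_div_of_pos (by norm_num)]
    simp
  rw [h, ENNReal.ofReal_le_iff_le_toReal hx]

open Finset in
open scoped Classical in
/-- No tester exists for a sample size at which most samples are interpolating, if most functions
are far from being polynomials. -/
theorem not_isSampleTester {n q d : ℕ} {ε : ℝ}
    (hdep : 6 * #{U ∈ powersetCard q (univ : Finset (Cube n)) | ¬ IsInterpolating d U} ≤
      (2 ^ n).choose q)
    (hfar : 6 * #{f : BoolFn n | ¬ IsFar ε f (Pol n d)} ≤ Fintype.card (BoolFn n))
    (A : SampleAlg n q) : ¬ IsSampleTester ε (Pol n d) q A := by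
  rintro ⟨hu, hacc, hrej⟩
  set C : ℝ := (((2 ^ n).choose q : ℕ) : ℝ) with hC
  have hCpos : 0 < C := by
    have : 0 < (2 ^ n).choose q := Nat.choose_pos (by simpa using hu)
    rw [hC]; exact_mod_cast this
  set α : BoolFn n → ℝ := fun f => ∑ U ∈ powersetCard q univ, A.verdictProb U (fun x => f x) true
    with hα
  set E : ℝ := (Fintype.card (BoolFn n) : ℝ) with hE
  set P : ℝ := (Fintype.card (polSubmodule n d) : ℝ) with hP
  have hEpos : 0 < E := by rw [hE]; exact_mod_cast Fintype.card_pos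
  have hPpos : 0 < P := by rw [hP]; exact_mod_cast Fintype.card_pos
  have hsumC : ∑ U ∈ powersetCard q (univ : Finset (Cube n)), (1 : ℝ) = C := by
    rw [sum_const, card_powersetCard]; simp [hC]
  have hsplit : ∀ f : BoolFn n, α f +
      ∑ U ∈ powersetCard q univ, A.verdictProb U (fun x => f x) false = C := by
    intro f
    rw [hα, ← sum_add_distrib, ← hsumC]
    exact sum_congr rfl fun U _ => A.verdictProb_add U _
  have hpol : ∀ f : polSubmodule n d, 2 / 3 * C ≤ α f := by
    intro f
    have h := (two_thirds_le_toReal (PMF.apply_ne_top _ _)).1 (hacc f.1 (mem_Pol_iff.2 f.2))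
    rw [hα]
    simp only
    rw [← A.toReal_outcome hu]
    exact mul_le_mul_of_nonneg_right h hCpos.le
  have hf : ∀ f : BoolFn n, α f ≤ C / 3 + if ¬ IsFar ε f (Pol n d) then 2 / 3 * C else 0 := by
    intro f
    have hs := hsplit f
    by_cases h : IsFar ε f (Pol n d)
    · rw [if_neg (not_not.2 h)]
      have h := (two_thirds_le_toReal (PMF.apply_ne_top _ _)).1 (hrej f h)
      rw [← A.toReal_outcome hu] at hs
      have := mul_le_mul_of_nonneg_right h hCpos.le
      linarith
    · rw [if_pos h]
      have : 0 ≤ ∑ U ∈ powersetCard q univ, A.verdictProb U (fun x => f x) false :=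
        sum_nonneg fun U _ => A.verdictProb_nonneg _ _ _
      linarith
  have h1 : P * (2 / 3 * C) ≤ ∑ f : polSubmodule n d, α f := by
    have := card_nsmul_le_sum univ (fun f : polSubmodule n d => α f) _ fun f _ => hpol f
    rwa [nsmul_eq_mul, card_univ] at this
  have h2 : ∑ f : BoolFn n, α f ≤ E * (C / 3) + E / 6 * (2 / 3 * C) := by
    refine (sum_le_sum fun f _ => hf f).trans ?_
    rw [sum_add_distrib, sum_const, card_univ, nsmul_eq_mul, ← sum_filter, sum_const, nsmul_eq_mul]
    have : (6 : ℝ) * #{f : BoolFn n | ¬ IsFar ε f (Pol n d)} ≤ E := by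
      rw [hE]; exact_mod_cast hfar
    gcongr
    linarith
  have h3 : E * ∑ f : polSubmodule n d, α f ≤ P * ∑ f : BoolFn n, α f + C / 6 * (E * P) := by
    have hU : ∀ U : Finset (Cube n),
        E * ∑ f : polSubmodule n d, A.verdictProb U (fun x => f.1 x) true ≤
        P * ∑ f : BoolFn n, A.verdictProb U (fun x => f x) true +
          if ¬ IsInterpolating d U then E * P else 0 := by
      intro U
      by_cases h : IsInterpolating d U
      · rw [if_neg (not_not.2 h), add_zero]
        exact (h.sum_restrict fun g => A.verdictProb U g true).le
      · rw [if_pos h]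
        have ha : ∑ f : polSubmodule n d, A.verdictProb U (fun x => f.1 x) true ≤ P := by
          have := sum_le_card_nsmul univ (fun f : polSubmodule n d =>
            A.verdictProb U (fun x => f.1 x) true) 1 fun f _ => by
              have := A.verdictProb_add U (fun x => f.1 x)
              have := A.verdictProb_nonneg U (fun x => f.1 x) false
              linarith
          simpa [hP] using this
        have hb : 0 ≤ ∑ f : BoolFn n, A.verdictProb U (fun x => f x) true :=
          sum_nonneg fun f _ => A.verdictProb_nonneg _ _ _
        have := mul_le_mul_of_nonneg_left ha hEpos.le
        have := mul_nonneg hPpos.le hb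
        linarith
    have hs := sum_le_sum fun U (_ : U ∈ powersetCard q (univ : Finset (Cube n))) => hU U
    rw [← mul_sum, sum_add_distrib, ← mul_sum, ← sum_filter, sum_const, nsmul_eq_mul,
      sum_comm, sum_comm (t := (univ : Finset (BoolFn n)))] at hs
    have hd : (#{U ∈ powersetCard q (univ : Finset (Cube n)) | ¬ IsInterpolating d U} : ℝ) ≤
        C / 6 := by
      have : (6 : ℝ) * #{U ∈ powersetCard q (univ : Finset (Cube n)) | ¬ IsInterpolating d U} ≤ C := by
        rw [hC]; exact_mod_cast hdep
      linarith
    have := mul_le_mul_of_nonneg_right hd (mul_pos hEpos hPpos).le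
    linarith
  have h4 := mul_le_mul_of_nonneg_left h1 hEpos.le
  have h5 := mul_le_mul_of_nonneg_left h2 hPpos.le
  -- After division by E * P * C the bounds read 2/3 ≤ 1/3 + (1/6)(2/3) + 1/6 = 11/18, which is
  -- false.
  have : 0 < E * P * C := by positivity
  nlinarith

/-! ### The interpolation tester and the upper bound -/

theorem QueryTree.exists_run_eq {X : Type} (l : List X) (F : List (ZMod 2) → Bool) :
    ∃ T : QueryTree X l.length, ∀ g, T.run g = F (l.map g) := by
  induction l generalizing F with
  | nil => exact ⟨.verdict (F []), fun g => by simp [QueryTree.run]⟩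
  | cons x l ih =>
    choose T hT using fun a : ZMod 2 => ih fun s => F (a :: s)
    exact ⟨.query x T, fun g => by simp [QueryTree.run, hT]⟩

theorem QueryTree.exists_run_eq_true_iff {X : Type} [Fintype X] {q : ℕ} (hq : Fintype.card X = q)
    (P : (X → ZMod 2) → Prop) : ∃ T : QueryTree X q, ∀ g, T.run g = true ↔ P g := by
  classical
  have hlen : (Finset.univ : Finset X).toList.length = q := by
    rw [Finset.length_toList, Finset.card_univ, hq]
  subst hlen
  obtain ⟨T, hT⟩ := QueryTree.exists_run_eq (Finset.univ : Finset X).toList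
    fun s => decide (∃ g, P g ∧ (Finset.univ : Finset X).toList.map g = s)
  refine ⟨T, fun g => ?_⟩
  rw [hT, decide_eq_true_iff]
  constructor
  · rintro ⟨g', hg', h⟩
    have : g' = g := funext fun x => List.map_inj_left.1 h x (by simp)
    rwa [← this]
  · exact fun h => ⟨g, h, rfl⟩

/-- There is an algorithm that queries the whole sample and applies a given rule to the answers. -/
theorem exists_sampleAlg (n q : ℕ) (P : (U : Finset (Cube n)) → (U → ZMod 2) → Prop) :
    ∃ A : SampleAlg n q, ∀ U : Finset (Cube n), U.card = q → ∀ h : U → ZMod 2,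
      (P U h → A.verdictProb U h true = 1) ∧ (¬ P U h → A.verdictProb U h false = 1) := by
  classical
  have hT : ∀ U : Finset (Cube n), ∃ T : QueryTree U q,
      U.card = q → ∀ h, T.run h = true ↔ P U h := by
    intro U
    by_cases hU : U.card = q
    · obtain ⟨T, hT⟩ := QueryTree.exists_run_eq_true_iff (X := U) (by simpa using hU) (P U)
      exact ⟨T, fun _ => hT⟩
    · exact ⟨.verdict true, fun h => absurd h hU⟩
  choose T hT using hT
  refine ⟨fun U => PMF.pure (T U), fun U hU h => ⟨fun hP => ?_, fun hP => ?_⟩⟩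
  · have h1 := (hT U hU h).2 hP
    simp [SampleAlg.verdictProb, PMF.pure_map, PMF.pure_apply, h1]
  · have h1 : (T U).run h = false := by
      rw [← Bool.not_eq_true]
      exact fun h' => hP ((hT U hU h).1 h')
    simp [SampleAlg.verdictProb, PMF.pure_map, PMF.pure_apply, h1]

/-- Sampling without replacement: each factor satisfies (M - i)/(N - i) ≤ M/N. -/
theorem choose_mul_pow_le {M N : ℕ} (h : M ≤ N) (q : ℕ) :
    M.choose q * N ^ q ≤ N.choose q * M ^ q := by
  have hd : M.descFactorial q * N ^ q ≤ N.descFactorial q * M ^ q := by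
    induction q with
    | zero => simp
    | succ q ih =>
      have h1 : (M - q) * N ≤ (N - q) * M := by
        rw [Nat.sub_mul, Nat.sub_mul, Nat.mul_comm N M]
        exact Nat.sub_le_sub_left (Nat.mul_le_mul_left q h) _
      calc M.descFactorial (q + 1) * N ^ (q + 1)
          = ((M - q) * N) * (M.descFactorial q * N ^ q) := by
            rw [Nat.descFactorial_succ]; ring
        _ ≤ ((N - q) * M) * (N.descFactorial q * M ^ q) := Nat.mul_le_mul h1 ih
        _ = _ := by rw [Nat.descFactorial_succ]; ring
  rw [Nat.descFactorial_eq_factorial_mul_choose, Nat.descFactorial_eq_factorial_mul_choose,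
    mul_assoc, mul_assoc] at hd
  exact Nat.le_of_mul_le_mul_left hd (Nat.factorial_pos q)

open Finset in
open scoped Classical in
theorem exists_isSampleTester {n d q : ℕ} {ε : ℝ} (hq : q ≤ 2 ^ n)
    (h : ∀ M : ℕ, (M : ℝ) ≤ (1 - ε) * 2 ^ n →
      3 * (2 ^ numMonomials n d * M.choose q) ≤ (2 ^ n).choose q) :
    ∃ A : SampleAlg n q, IsSampleTester ε (Pol n d) q A := by
  obtain ⟨A, hA⟩ := exists_sampleAlg n q fun U h => ∃ g : polSubmodule n d, ∀ x : U, h x = g.1 x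
  have hu : q ≤ (univ : Finset (Cube n)).card := by simpa using hq
  have hCpos : (0 : ℝ) < ((2 ^ n).choose q : ℕ) := by exact_mod_cast Nat.choose_pos hq
  have hcard : #(powersetCard q (univ : Finset (Cube n))) = (2 ^ n).choose q := by simp
  refine ⟨A, hu, fun f hf => ?_, fun f hf => ?_⟩
  · rw [two_thirds_le_toReal (PMF.apply_ne_top _ _)]
    refine le_of_mul_le_mul_right ?_ hCpos
    rw [A.toReal_outcome hu, sum_congr rfl fun U hU => (hA U (mem_powersetCard_univ.1 hU) _).1
      ⟨⟨f, mem_Pol_iff.1 hf⟩, fun x => rfl⟩, sum_const, hcard, nsmul_eq_mul, mul_one]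
    linarith
  · rw [two_thirds_le_toReal (PMF.apply_ne_top _ _)]
    refine le_of_mul_le_mul_right ?_ hCpos
    rw [A.toReal_outcome hu]
    set bad : Finset (Finset (Cube n)) :=
      {U ∈ powersetCard q univ | ∃ g : polSubmodule n d, ∀ x : U, f x = g.1 x} with hbad
    have h1 : ∀ g : polSubmodule n d,
        3 * (2 ^ numMonomials n d * #{U ∈ powersetCard q (univ : Finset (Cube n)) |
          ∀ x ∈ U, f x = g.1 x}) ≤ (2 ^ n).choose q := by
      intro g
      have hsub : #{U ∈ powersetCard q (univ : Finset (Cube n)) | ∀ x ∈ U, f x = g.1 x} ≤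
          (#{x | f x = g.1 x}).choose q := by
        rw [← card_powersetCard]
        refine card_le_card fun U hU => ?_
        simp only [mem_filter, mem_powersetCard] at hU ⊢
        exact ⟨fun x hx => by simpa using hU.2 x hx, hU.1.2⟩
      refine le_trans (by gcongr) (h #{x | f x = g.1 x} ?_)
      have hd : #{x | f x = g.1 x} + hammingDist f g.1 = 2 ^ n := by
        rw [hammingDist, card_filter_add_card_filter_not]
        simp
      have hfar := hf g.1 (mem_Pol_iff.2 g.2)
      have hd' : (#{x | f x = g.1 x} : ℝ) + hammingDist f g.1 = 2 ^ n := by exact_mod_cast hd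
      linarith
    have h2 : 3 * #bad ≤ (2 ^ n).choose q := by
      have hU : bad ⊆ (univ : Finset (polSubmodule n d)).biUnion fun g =>
          {U ∈ powersetCard q (univ : Finset (Cube n)) | ∀ x ∈ U, f x = g.1 x} := by
        intro U hU
        rw [hbad, mem_filter] at hU
        obtain ⟨hU, g, hg⟩ := hU
        exact mem_biUnion.2 ⟨g, mem_univ _, mem_filter.2 ⟨hU, fun x hx => hg ⟨x, hx⟩⟩⟩
      have hb := (card_le_card hU).trans card_biUnion_le
      have hP : #(univ : Finset (polSubmodule n d)) ≤ 2 ^ numMonomials n d := by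
        rw [card_univ, ← Nat.card_eq_fintype_card]
        exact card_polSubmodule_le n d
      have hs := sum_le_card_nsmul (univ : Finset (polSubmodule n d)) (fun g =>
        2 ^ numMonomials n d * (3 * #{U ∈ powersetCard q (univ : Finset (Cube n)) |
          ∀ x ∈ U, f x = g.1 x})) ((2 ^ n).choose q) fun g _ => by
            have := h1 g
            rwa [mul_left_comm] at this
      rw [← mul_sum, ← mul_sum, smul_eq_mul] at hs
      have h3 := Nat.mul_le_mul_right ((2 ^ n).choose q) hP
      have h4 := Nat.le_of_mul_le_mul_left (hs.trans h3) (by positivity)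
      omega
    have h3 : ∀ U ∈ powersetCard q (univ : Finset (Cube n)),
        (1 : ℝ) - (if ∃ g : polSubmodule n d, ∀ x : U, f x = g.1 x then 1 else 0) ≤
        A.verdictProb U (fun x => f x) false := by
      intro U hU
      by_cases hg : ∃ g : polSubmodule n d, ∀ x : U, f x = g.1 x
      · rw [if_pos hg, sub_self]
        exact A.verdictProb_nonneg _ _ _
      · rw [if_neg hg, (hA U (mem_powersetCard_univ.1 hU) _).2 hg, sub_zero]
    refine le_trans ?_ (sum_le_sum h3)
    rw [sum_sub_distrib, sum_const, hcard, nsmul_eq_mul, mul_one, ← sum_filter, sum_const,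
      nsmul_eq_mul, mul_one]
    have h4 : (3 : ℝ) * #bad ≤ ((2 ^ n).choose q : ℕ) := by exact_mod_cast h2
    rw [hbad] at h4
    linarith

theorem one_le_numMonomials (n d : ℕ) : 1 ≤ numMonomials n d := by
  have := Finset.single_le_sum (f := fun i => n.choose i) (fun i _ => Nat.zero_le _)
    (Finset.mem_range.2 (Nat.succ_pos d))
  simpa [numMonomials] using this

theorem exists_isSampleTester_le {ε : ℝ} (hε : 0 < ε) (hε' : ε < 1) {K : ℕ}
    (hK : (1 - ε) ^ K ≤ 1 / 6) (n d : ℕ) :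
    ∃ q ≤ K * numMonomials n d, ∃ A : SampleAlg n q, IsSampleTester ε (Pol n d) q A := by
  have hN : (0 : ℝ) < 2 ^ n := by positivity
  rcases le_or_gt (K * numMonomials n d) (2 ^ n) with hle | hlt
  · refine ⟨_, le_rfl, exists_isSampleTester hle fun M hM => ?_⟩
    set q := K * numMonomials n d with hq
    have hMN : M ≤ 2 ^ n := by
      have : (M : ℝ) ≤ (2 ^ n : ℕ) := by push_cast; nlinarith
      exact_mod_cast this
    have h1 : (M.choose q : ℝ) * (2 ^ n) ^ q ≤ (2 ^ n).choose q * (M : ℝ) ^ q := by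
      exact_mod_cast choose_mul_pow_le hMN q
    have h2 : (M : ℝ) ^ q ≤ (1 / 6) ^ numMonomials n d * (2 ^ n) ^ q := by
      calc (M : ℝ) ^ q ≤ ((1 - ε) * 2 ^ n) ^ q := by gcongr
        _ = ((1 - ε) ^ K) ^ numMonomials n d * (2 ^ n) ^ q := by rw [mul_pow, ← pow_mul (1 - ε)]
        _ ≤ _ := by
          gcongr
    have h3 : (M.choose q : ℝ) ≤ (2 ^ n).choose q * (1 / 6) ^ numMonomials n d := by
      refine le_of_mul_le_mul_right ?_ (pow_pos hN q)
      refine h1.trans ?_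
      rw [mul_assoc]
      gcongr
    have h4 : (2 : ℝ) ^ numMonomials n d * (1 / 6) ^ numMonomials n d ≤ 1 / 3 := by
      rw [← mul_pow]
      refine (pow_le_pow_of_le_one (by norm_num) (by norm_num) (one_le_numMonomials n d)).trans ?_
      norm_num
    have h5 : (3 : ℝ) * (2 ^ numMonomials n d * M.choose q) ≤ (2 ^ n).choose q := by
      calc (3 : ℝ) * (2 ^ numMonomials n d * M.choose q)
          ≤ 3 * (2 ^ numMonomials n d * ((2 ^ n).choose q * (1 / 6) ^ numMonomials n d)) := by gcongr
        _ = 3 * (2 ^ n).choose q * (2 ^ numMonomials n d * (1 / 6) ^ numMonomials n d) := by ring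
        _ ≤ 3 * (2 ^ n).choose q * (1 / 3) := by gcongr
        _ = _ := by ring
    exact_mod_cast h5
  -- The sample is now the whole cube, and no polynomial agrees everywhere with a far function.
  · refine ⟨2 ^ n, hlt.le, exists_isSampleTester le_rfl fun M hM => ?_⟩
    have hMN : M < 2 ^ n := by
      have : (M : ℝ) < (2 ^ n : ℕ) := by push_cast; nlinarith
      exact_mod_cast this
    rw [Nat.choose_eq_zero_of_lt hMN]
    simp

theorem passiveQueryComplexity_le {ε : ℝ} (hε : 0 < ε) (hε' : ε < 1) {K : ℕ}
    (hK : (1 - ε) ^ K ≤ 1 / 6) (n d : ℕ) :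
    passiveQueryComplexity ε (Pol n d) ≤ K * numMonomials n d := by
  obtain ⟨q, hq, hA⟩ := exists_isSampleTester_le hε hε' hK n d
  exact (Nat.sInf_le hA).trans hq

/-- The upper bound makes the set of admissible q nonempty, so its `sInf` is attained and is not the
default 0. -/
theorem exists_isSampleTester_passiveQueryComplexity {ε : ℝ} (hε : 0 < ε) (hε' : ε < 1) (n d : ℕ) :
    ∃ A : SampleAlg n (passiveQueryComplexity ε (Pol n d)),
      IsSampleTester ε (Pol n d) (passiveQueryComplexity ε (Pol n d)) A := by
  obtain ⟨K, hK⟩ := exists_pow_lt_of_lt_one (by norm_num : (0 : ℝ) < 1 / 6)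
    (by linarith : 1 - ε < 1)
  obtain ⟨q, _, hA⟩ := exists_isSampleTester_le hε hε' hK.le n d
  exact Nat.sInf_mem (s := {q | ∃ A : SampleAlg n q, IsSampleTester ε (Pol n d) q A}) ⟨q, hA⟩

/-! ### Most functions are far from all polynomials -/

/-- Expand a product over the points of X in which the value of g contributes 1 and the other value
r. -/
theorem sum_pow_hammingDist {X : Type*} [Fintype X] [DecidableEq X] (g : X → ZMod 2) (r : ℝ) :
    ∑ f : X → ZMod 2, r ^ hammingDist f g = (1 + r) ^ Fintype.card X := by
  have h := Finset.prod_univ_sum (fun _ : X => (Finset.univ : Finset (ZMod 2)))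
    fun x a => if a = g x then 1 else r
  rw [Fintype.piFinset_univ] at h
  have h1 : ∀ b : ZMod 2, ∑ a : ZMod 2, (if a = b then 1 else r) = 1 + r := by
    intro b
    have h01 : ∀ F : ZMod 2 → ℝ, ∑ a, F a = F 0 + F 1 := fun F => Fin.sum_univ_two F
    rw [h01]
    have hb : b = 0 ∨ b = 1 := by revert b; decide
    rcases hb with rfl | rfl
    · simp
    · simp [add_comm]
  simp only [h1, Finset.prod_const, Finset.card_univ] at h
  rw [h]
  refine Finset.sum_congr rfl fun f _ => ?_
  rw [Finset.prod_ite, Finset.prod_const_one, one_mul, Finset.prod_const]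
  rfl

theorem exists_ball_ratio {ε : ℝ} (hε : 0 < ε) (hε' : ε < 1 / 2) :
    ∃ r ρ : ℝ, 0 < r ∧ r ≤ 1 ∧ 0 < ρ ∧ ρ < 1 ∧ 1 + r = 2 * ρ * r ^ ε := by
  -- Any r with 2ε < r < 1 would do; this is the midpoint.
  set r := 1 / 2 + ε with hr
  have hr0 : 0 < r := by positivity
  have hpos : 0 < r ^ ε := Real.rpow_pos_of_pos hr0 ε
  refine ⟨r, (1 + r) / (2 * r ^ ε), hr0, by linarith, by positivity, ?_, by field_simp⟩
  rw [div_lt_one (by positivity)]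
  have h1 : (1 + r) / 2 ≤ Real.exp (-(1 - r) / 2) := by
    have := Real.add_one_le_exp (-(1 - r) / 2)
    linarith
  have h2 : Real.exp (-(1 - r) / 2) < r ^ ε := by
    rw [Real.rpow_def_of_pos hr0, Real.exp_lt_exp]
    have h3 := Real.one_sub_inv_le_log_of_pos hr0
    have h4 : (1 - r⁻¹) * ε ≤ Real.log r * ε := mul_le_mul_of_nonneg_right h3 hε.le
    refine lt_of_lt_of_le ?_ h4
    have h5 : (1 - r⁻¹) * ε - -(1 - r) / 2 = (1 - r) * (r / 2 - ε) / r := by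
      field_simp
      ring
    have h6 : 0 < (1 - r) * (r / 2 - ε) / r :=
      div_pos (mul_pos (by linarith) (by linarith)) hr0
    linarith
  linarith

open Finset in
open scoped Classical in
/-- Few functions are close to a given function. -/
theorem card_ball_le {n : ℕ} {ε r ρ : ℝ} (hr : 0 < r) (hr1 : r ≤ 1)
    (h : 1 + r = 2 * ρ * r ^ ε) (g : BoolFn n) :
    (#{f : BoolFn n | ¬ ε * 2 ^ n ≤ hammingDist f g} : ℝ) ≤
      Fintype.card (BoolFn n) * ρ ^ 2 ^ n := by
  have hE : (Fintype.card (BoolFn n) : ℝ) = 2 ^ 2 ^ n := by simp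
  have hsum := sum_pow_hammingDist g r
  have hX : Fintype.card (Cube n) = 2 ^ n := by simp
  rw [hX] at hsum
  have hpow : (r ^ ε) ^ 2 ^ n = r ^ (ε * 2 ^ n) := by
    rw [← Real.rpow_natCast, ← Real.rpow_mul hr.le]
    norm_num
  have hpos : 0 < r ^ (ε * 2 ^ n) := Real.rpow_pos_of_pos hr _
  have h1 : #{f : BoolFn n | ¬ ε * 2 ^ n ≤ hammingDist f g} • r ^ (ε * 2 ^ n) ≤
      ∑ f : BoolFn n with ¬ ε * 2 ^ n ≤ hammingDist f g, r ^ hammingDist f g := by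
    refine card_nsmul_le_sum _ _ _ fun f hf => ?_
    simp only [mem_filter, mem_univ, true_and, not_le] at hf
    rw [← Real.rpow_natCast r]
    exact Real.rpow_le_rpow_of_exponent_ge hr hr1 hf.le
  have h2 : ∑ f : BoolFn n with ¬ ε * 2 ^ n ≤ hammingDist f g, r ^ hammingDist f g ≤
      ∑ f : BoolFn n, r ^ hammingDist f g :=
    sum_le_sum_of_subset_of_nonneg (filter_subset _ _) fun _ _ _ => by positivity
  have h3 := h1.trans h2
  rw [hsum, nsmul_eq_mul, h, mul_pow, mul_pow, hpow] at h3
  rw [hE]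
  exact le_of_mul_le_mul_right h3 hpos

-- Union bound over at most 2^(n_d) Hamming balls, each of density at most ρ^(2^n) ≤ 12^(-n_d).
open Finset in
open scoped Classical in
theorem card_not_isFar_le {ε : ℝ} (hε : 0 < ε) (hε' : ε < 1 / 2) :
    ∃ s : ℕ, ∀ n d : ℕ, s * numMonomials n d ≤ 2 ^ n →
      6 * #{f : BoolFn n | ¬ IsFar ε f (Pol n d)} ≤ Fintype.card (BoolFn n) := by
  obtain ⟨r, ρ, hr, hr1, hρ, hρ1, h⟩ := exists_ball_ratio hε hε'
  obtain ⟨s, hs⟩ := exists_pow_lt_of_lt_one (by norm_num : (0 : ℝ) < 1 / 12) hρ1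
  refine ⟨s, fun n d hn => ?_⟩
  have hsub : ({f : BoolFn n | ¬ IsFar ε f (Pol n d)} : Finset _) ⊆
      (univ : Finset (polSubmodule n d)).biUnion fun g =>
        {f : BoolFn n | ¬ ε * 2 ^ n ≤ hammingDist f g.1} := by
    intro f hf
    have hf := (mem_filter.1 hf).2
    unfold IsFar at hf
    push Not at hf
    obtain ⟨g, hg, hlt⟩ := hf
    exact mem_biUnion.2 ⟨⟨g, mem_Pol_iff.1 hg⟩, mem_univ _, by simpa using hlt⟩
  have hP : #(univ : Finset (polSubmodule n d)) ≤ 2 ^ numMonomials n d := by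
    rw [card_univ, ← Nat.card_eq_fintype_card]
    exact card_polSubmodule_le n d
  have h1 : (#{f : BoolFn n | ¬ IsFar ε f (Pol n d)} : ℝ) ≤
      2 ^ numMonomials n d * (Fintype.card (BoolFn n) * ρ ^ 2 ^ n) := by
    have hb : (#{f : BoolFn n | ¬ IsFar ε f (Pol n d)} : ℝ) ≤
        ∑ g : polSubmodule n d, (#{f : BoolFn n | ¬ ε * 2 ^ n ≤ hammingDist f g.1} : ℝ) := by
      exact_mod_cast (card_le_card hsub).trans card_biUnion_le
    refine hb.trans ((sum_le_card_nsmul _ _ _ fun g _ => card_ball_le hr hr1 h g.1).trans ?_)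
    rw [nsmul_eq_mul]
    gcongr
    exact_mod_cast hP
  have h2 : ρ ^ 2 ^ n ≤ (1 / 12) ^ numMonomials n d := by
    refine (pow_le_pow_of_le_one hρ.le hρ1.le hn).trans ?_
    rw [pow_mul]
    gcongr
  have h3 : (2 : ℝ) ^ numMonomials n d * (1 / 12) ^ numMonomials n d ≤ 1 / 6 := by
    rw [← mul_pow]
    refine (pow_le_pow_of_le_one (by norm_num) (by norm_num) (one_le_numMonomials n d)).trans ?_
    norm_num
  have h4 : (6 : ℝ) * #{f : BoolFn n | ¬ IsFar ε f (Pol n d)} ≤ Fintype.card (BoolFn n) := by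
    calc (6 : ℝ) * #{f : BoolFn n | ¬ IsFar ε f (Pol n d)}
        ≤ 6 * (2 ^ numMonomials n d * (Fintype.card (BoolFn n) * (1 / 12) ^ numMonomials n d)) := by
          refine mul_le_mul_of_nonneg_left (h1.trans ?_) (by norm_num)
          gcongr
      _ = 6 * Fintype.card (BoolFn n) *
          (2 ^ numMonomials n d * (1 / 12) ^ numMonomials n d) := by ring
      _ ≤ 6 * Fintype.card (BoolFn n) * (1 / 6) := by gcongr
      _ = _ := by ring
  exact_mod_cast h4

/-! ### Parameters of the lower bound -/

open Finset in
open scoped Classical in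
theorem card_not_isInterpolating_le_choose {n d q k : ℕ} (hkn : k ≤ n) (hq : q ≤ k.choose d)
    (hk : ∑ i ∈ range d, n.choose i ≤ 2 ^ k) (hqk : 13 * q * 2 ^ k ≤ 2 ^ n) :
    6 * #{U ∈ powersetCard q (univ : Finset (Cube n)) | ¬ IsInterpolating d U} ≤
      (2 ^ n).choose q := by
  rcases q with _ | q
  · rw [filter_false_of_mem]
    · simp
    · intro U hU
      rw [powersetCard_zero, mem_singleton] at hU
      simp [hU, IsInterpolating]
  · have h1 := card_not_isInterpolating_le (n := n) (d := d) (q := q) (M := 2 ^ k + 2 ^ k)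
      fun T hT => (card_degreeClosure_le T hkn (by omega)).trans (by omega)
    refine (Nat.mul_le_mul_left 6 h1).trans ?_
    have hk1 : 1 ≤ 2 ^ k := Nat.one_le_two_pow
    -- Twelve of the 13 parts pay for the bad points, the last one for the subtracted q.
    have h2 : 6 * (2 ^ k + 2 ^ k) * (q + 1) ≤ 2 ^ n - q := by
      have : q ≤ (q + 1) * 2 ^ k := by nlinarith
      have : 6 * (2 ^ k + 2 ^ k) * (q + 1) + (q + 1) * 2 ^ k = 13 * (q + 1) * 2 ^ k := by ring
      omega
    refine Nat.le_of_mul_le_mul_right ?_ (Nat.succ_pos q)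
    rw [Nat.succ_eq_add_one, Nat.choose_succ_right_eq]
    calc 6 * ((2 ^ n).choose q * (2 ^ k + 2 ^ k)) * (q + 1)
        = (2 ^ n).choose q * (6 * (2 ^ k + 2 ^ k) * (q + 1)) := by ring
      _ ≤ _ := Nat.mul_le_mul_left _ h2

theorem numMonomials_succ (n d : ℕ) :
    numMonomials n (d + 1) = numMonomials n d + n.choose (d + 1) :=
  Finset.sum_range_succ _ _

theorem choose_le_numMonomials (n d : ℕ) : n.choose d ≤ numMonomials n d :=
  Finset.single_le_sum (f := fun i => n.choose i) (fun _ _ => Nat.zero_le _)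
    (Finset.mem_range.2 (Nat.lt_succ_self d))

/-- In this range consecutive binomials at least double, so the sum is dominated geometrically by
its last term. -/
theorem numMonomials_le_two_mul_choose {n d : ℕ} (h : 3 * d ≤ n + 1) :
    numMonomials n d ≤ 2 * n.choose d := by
  induction d with
  | zero => simp [numMonomials]
  | succ d ih =>
    have h1 := ih (by omega)
    have h2 : 2 * n.choose d ≤ n.choose (d + 1) := by
      refine Nat.le_of_mul_le_mul_right ?_ (Nat.succ_pos d)
      rw [Nat.succ_eq_add_one, Nat.choose_succ_right_eq]
      calc 2 * n.choose d * (d + 1) = n.choose d * (2 * (d + 1)) := by ring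
        _ ≤ _ := Nat.mul_le_mul_left _ (by omega)
    rw [numMonomials_succ]
    omega

/-- A (d+1)-set either avoids j marked points or contains one of them. -/
theorem choose_add_le (k j d : ℕ) :
    (k + j).choose (d + 1) ≤ k.choose (d + 1) + j * (k + j - 1).choose d := by
  induction j with
  | zero => simp
  | succ j ih =>
    have h1 : (k + j - 1).choose d ≤ (k + j).choose d := Nat.choose_le_choose d (Nat.sub_le _ _)
    have h2 := Nat.mul_le_mul_left j h1
    rw [← add_assoc, Nat.choose_succ_succ', Nat.add_sub_cancel, add_mul]
    omega

/-- Removing few elements at most halves a binomial coefficient. -/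
theorem choose_le_two_mul_choose {k j d : ℕ} (hpos : 0 < k + j) (h : 2 * j * (d + 1) ≤ k + j) :
    (k + j).choose (d + 1) ≤ 2 * k.choose (d + 1) := by
  have h1 := choose_add_le k j d
  obtain ⟨n, hn⟩ : ∃ n, k + j = n + 1 := ⟨k + j - 1, by omega⟩
  rw [hn] at h1 h ⊢
  rw [Nat.add_sub_cancel] at h1
  have h2 := Nat.add_one_mul_choose_eq n d
  refine Nat.le_of_mul_le_mul_left ?_ (Nat.succ_pos n)
  have h3 : 2 * (n + 1) * (n + 1).choose (d + 1) ≤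
      2 * (n + 1) * (k.choose (d + 1) + j * n.choose d) := Nat.mul_le_mul_left _ h1
  have h4 := Nat.mul_le_mul_right ((n + 1).choose (d + 1)) h
  have h5 : 2 * (n + 1) * (j * n.choose d) = 2 * j * (d + 1) * (n + 1).choose (d + 1) := by
    calc _ = 2 * j * ((n + 1) * n.choose d) := by ring
      _ = _ := by rw [h2]; ring
  rw [Nat.mul_add _ (k.choose _), h5] at h3
  rw [Nat.succ_eq_add_one]
  nlinarith

theorem numMonomials_le_four_mul_choose {n d : ℕ} (hd : 1 ≤ d) (h : 4 * d ≤ n) :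
    numMonomials n d ≤ 4 * (n - n / (4 * d) - 1).choose d := by
  obtain ⟨d, rfl⟩ : ∃ e, d = e + 1 := ⟨d - 1, by omega⟩
  have h1 := numMonomials_le_two_mul_choose (n := n) (d := d + 1) (by omega)
  set m := n / (4 * (d + 1)) with hm
  have hm1 : 4 * (d + 1) * m ≤ n := Nat.mul_div_le n _
  have hm2 : 4 * m ≤ n := le_trans (by nlinarith) hm1
  have hk : n - m - 1 + (m + 1) = n := by omega
  have h2 := choose_le_two_mul_choose (k := n - m - 1) (j := m + 1) (d := d) (by omega) (by
    rw [hk]; nlinarith)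
  rw [hk] at h2
  omega

-- With y = n^(1/3) ≥ d, one has 4d(3 + d log₂ n) ≤ d² · 4(3 + log₂ n) ≤ d² y ≤ n once y ≥ 4(3 +
-- log₂ n).
open Filter in
theorem eventually_four_mul_pow_le : ∃ n₀ : ℕ, ∀ n d : ℕ, n₀ ≤ n → 1 ≤ d →
    (d : ℝ) ≤ (n : ℝ) ^ ((1 : ℝ) / 3) → 4 * n ^ d ≤ 2 ^ (n / (4 * d)) := by
  have hlog : ∀ᶠ x : ℝ in atTop, 4 * (3 + Real.logb 2 x) ≤ x ^ ((1 : ℝ) / 3) := by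
    have h1 := (isLittleO_log_rpow_atTop (by norm_num : (0 : ℝ) < 1 / 3)).def
      (c := Real.log 2 / 8) (by positivity)
    have h2 : ∀ᶠ x : ℝ in atTop, (24 : ℝ) ≤ x ^ ((1 : ℝ) / 3) :=
      (tendsto_rpow_atTop (by norm_num : (0 : ℝ) < 1 / 3)).eventually_ge_atTop 24
    filter_upwards [h1, h2] with x hx1 hx2
    rw [Real.norm_eq_abs, Real.norm_of_nonneg (by linarith)] at hx1
    have hl : 0 < Real.log 2 := Real.log_pos (by norm_num)
    have h3 : Real.logb 2 x ≤ x ^ ((1 : ℝ) / 3) / 8 := by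
      rw [Real.logb, div_le_iff₀ hl]
      linarith [le_abs_self (Real.log x)]
    linarith
  obtain ⟨n₀, hn₀⟩ := eventually_atTop.1 (tendsto_natCast_atTop_atTop.eventually hlog)
  refine ⟨max n₀ 1, fun n d hn hd hdn => ?_⟩
  have hL := hn₀ n ((le_max_left _ _).trans hn)
  have hn1 : 1 ≤ n := (le_max_right _ _).trans hn
  have hnpos : (0 : ℝ) < n := by exact_mod_cast hn1
  have hd1 : (1 : ℝ) ≤ d := by exact_mod_cast hd
  set y := (n : ℝ) ^ ((1 : ℝ) / 3) with hy
  have hy3 : y * y * y = n := by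
    rw [hy, ← Real.rpow_add hnpos, ← Real.rpow_add hnpos]
    norm_num
  have hlogn : 0 ≤ Real.logb 2 n := Real.logb_nonneg (by norm_num) (by exact_mod_cast hn1)
  have hexp : 3 + d * Real.logb 2 n ≤ (n : ℝ) / (4 * d) := by
    rw [le_div_iff₀ (by positivity)]
    have h1 : (3 + d * Real.logb 2 n) ≤ d * (y / 4) := by nlinarith
    calc (3 + d * Real.logb 2 n) * (4 * d) ≤ d * (y / 4) * (4 * d) := by gcongr
      _ = d * d * y := by ring
      _ ≤ y * y * y := by gcongr
      _ = n := hy3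
  have hfloor : (n : ℝ) / (4 * d) ≤ ((n / (4 * d) : ℕ) : ℝ) + 1 := by
    rw [div_le_iff₀ (by positivity)]
    have := (Nat.lt_mul_div_succ n (by omega : 0 < 4 * d)).le
    have h' : (n : ℝ) ≤ (4 * d : ℕ) * ((n / (4 * d) + 1 : ℕ) : ℝ) := by exact_mod_cast this
    push_cast at h' ⊢
    linarith
  have hn2 : (2 : ℝ) ^ Real.logb 2 n = n := Real.rpow_logb (by norm_num) (by norm_num) hnpos
  have hmain : (4 : ℝ) * (n : ℝ) ^ d ≤ 2 ^ (n / (4 * d)) := by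
    calc (4 : ℝ) * (n : ℝ) ^ d = 2 ^ ((2 : ℝ) + Real.logb 2 n * d) := by
          rw [Real.rpow_add (by norm_num), Real.rpow_mul (by norm_num), hn2, Real.rpow_natCast]
          norm_num
      _ ≤ 2 ^ (((n / (4 * d) : ℕ) : ℝ)) :=
        Real.rpow_le_rpow_of_exponent_le (by norm_num) (by linarith)
      _ = _ := Real.rpow_natCast _ _
  exact_mod_cast hmain

theorem exists_lower_bound {ε : ℝ} (hε : 0 < ε) (hε' : ε < 1 / 2) :
    ∃ n₀ : ℕ, ∀ n d : ℕ, n₀ ≤ n → 1 ≤ d → (d : ℝ) ≤ (n : ℝ) ^ ((1 : ℝ) / 3) →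
      numMonomials n d ≤ 4 * passiveQueryComplexity ε (Pol n d) := by
  obtain ⟨s, hs⟩ := card_not_isFar_le hε hε'
  obtain ⟨n₀, hn₀⟩ := eventually_four_mul_pow_le
  -- The 2s leaves room for s + m ≤ n; the 64 gives 4d ≤ n when d ≤ 16, while d³ ≤ n covers larger
  -- d.
  refine ⟨max n₀ (2 * s + 64), fun n d hn hd hdn => ?_⟩
  have hpow := hn₀ n d (by omega) hd hdn
  have hd3 : d ^ 3 ≤ n := by
    have h1 : (d : ℝ) ^ 3 ≤ n := by
      calc (d : ℝ) ^ 3 ≤ ((n : ℝ) ^ ((1 : ℝ) / 3)) ^ 3 := by gcongr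
        _ = (n : ℝ) := by
          rw [← Real.rpow_natCast, ← Real.rpow_mul (Nat.cast_nonneg n)]
          norm_num
    exact_mod_cast h1
  have h4d : 4 * d ≤ n := by
    rcases le_or_gt d 16 with h | h
    · omega
    · calc 4 * d ≤ d * d * d := Nat.mul_le_mul_right d (by nlinarith)
        _ = d ^ 3 := by ring
        _ ≤ n := hd3
  set m := n / (4 * d) with hm
  have hm1 : 4 * m ≤ n := le_trans (by nlinarith) (Nat.mul_div_le n (4 * d))
  have hchoose := numMonomials_le_four_mul_choose hd h4d
  rw [← hm] at hchoose
  have hsmall : 2 * numMonomials n d ≤ 2 ^ m := by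
    have h1 := numMonomials_le_two_mul_choose (n := n) (d := d) (by omega)
    have h2 := Nat.choose_le_pow n d
    omega
  have hfar : s * numMonomials n d ≤ 2 ^ n := by
    calc s * numMonomials n d ≤ 2 ^ s * 2 ^ m :=
          Nat.mul_le_mul Nat.lt_two_pow_self.le (by omega)
      _ = 2 ^ (s + m) := (pow_add _ _ _).symm
      _ ≤ 2 ^ n := Nat.pow_le_pow_right (by norm_num) (by omega)
  by_contra! hlt
  obtain ⟨A, hA⟩ := exists_isSampleTester_passiveQueryComplexity hε (by linarith) n d
  refine not_isSampleTester ?_ (hs n d hfar) A hA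
  -- If q is the complexity, 4q < n_d ≤ 4 C(k, d) gives q < C(k, d), and 2 n_d ≤ 2^m gives 13q ≤ 4
  -- n_d ≤ 2 · 2^m = 2^(n-k).
  refine card_not_isInterpolating_le_choose (k := n - m - 1) (by omega) (by omega) ?_ ?_
  · have h1 : ∑ i ∈ Finset.range d, n.choose i ≤ numMonomials n d :=
      Finset.sum_le_sum_of_subset (Finset.range_mono (Nat.le_succ d))
    have h2 : 2 ^ m ≤ 2 ^ (n - m - 1) := Nat.pow_le_pow_right (by norm_num) (by omega)
    omega
  · have h1 : 2 ^ n = 2 * 2 ^ m * 2 ^ (n - m - 1) := by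
      rw [← pow_succ', ← pow_add]
      congr 1
      omega
    rw [h1]
    exact Nat.mul_le_mul_right _ (by omega)

/-- Covers d = 0, where n_d = 1: the empty sample is trivially interpolating, so zero queries cannot
suffice. -/
theorem eventually_one_le_passiveQueryComplexity {ε : ℝ} (hε : 0 < ε) (hε' : ε < 1 / 2) :
    ∃ n₀ : ℕ, ∀ n, n₀ ≤ n → 1 ≤ passiveQueryComplexity ε (Pol n 0) := by
  obtain ⟨s, hs⟩ := card_not_isFar_le hε hε'
  refine ⟨s, fun n hn => ?_⟩
  by_contra! hlt
  obtain ⟨A, hA⟩ := exists_isSampleTester_passiveQueryComplexity hε (by linarith) n 0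
  refine not_isSampleTester ?_ (hs n 0 ?_) A hA
  · exact card_not_isInterpolating_le_choose (k := 0) (by omega) (by omega) (by simp)
      (by simp [Nat.lt_one_iff.1 hlt])
  · simpa [numMonomials] using hn.trans Nat.lt_two_pow_self.le

/-! ### Asymptotics and conclusion -/

open Filter in
theorem isTheta_numMonomials (d : ℕ) :
    (fun n : ℕ => (numMonomials n d : ℝ)) =Θ[atTop] (fun n : ℕ => (n : ℝ) ^ d) := by
  have h1 : (fun n : ℕ => (numMonomials n d : ℝ)) =Θ[atTop] (fun n : ℕ => (n.choose d : ℝ)) := by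
    constructor
    · refine Asymptotics.IsBigO.of_bound 2 ?_
      filter_upwards [eventually_ge_atTop (3 * d)] with n hn
      rw [Real.norm_natCast, Real.norm_natCast]
      exact_mod_cast numMonomials_le_two_mul_choose (by omega)
    · refine Asymptotics.IsBigO.of_bound 1 (Eventually.of_forall fun n => ?_)
      rw [Real.norm_natCast, Real.norm_natCast, one_mul]
      exact_mod_cast choose_le_numMonomials n d
  exact h1.trans (isTheta_choose d)

open Filter in
theorem theorem3 (ε : ℝ) (hε₀ : 0 < ε) (hε₁ : ε < 1 / 2) :
    (∃ c C : ℝ, ∃ n₀ : ℕ, 0 < c ∧ 0 < C ∧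
      ∀ n d : ℕ, n₀ ≤ n → 1 ≤ d → (d : ℝ) ≤ (n : ℝ) ^ ((1 : ℝ) / 3) →
        c * (numMonomials n d : ℝ) ≤ (passiveQueryComplexity ε (Pol n d) : ℝ) ∧
        (passiveQueryComplexity ε (Pol n d) : ℝ) ≤ C * (numMonomials n d : ℝ)) ∧
    (∀ d : ℕ,
      (fun n : ℕ => (numMonomials n d : ℝ)) =Θ[Filter.atTop] (fun n : ℕ => (n : ℝ) ^ d) ∧
      (fun n : ℕ => (passiveQueryComplexity ε (Pol n d) : ℝ)) =Θ[Filter.atTop]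
        (fun n : ℕ => (n : ℝ) ^ d)) := by
  obtain ⟨K, hK⟩ := exists_pow_lt_of_lt_one (by norm_num : (0 : ℝ) < 1 / 6)
    (by linarith : 1 - ε < 1)
  have hupper : ∀ n d, (passiveQueryComplexity ε (Pol n d) : ℝ) ≤ K * numMonomials n d := by
    intro n d
    exact_mod_cast passiveQueryComplexity_le hε₀ (by linarith) hK.le n d
  obtain ⟨n₀, hn₀⟩ := exists_lower_bound hε₀ hε₁
  have hlower : ∀ n d : ℕ, n₀ ≤ n → 1 ≤ d → (d : ℝ) ≤ (n : ℝ) ^ ((1 : ℝ) / 3) →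
      (numMonomials n d : ℝ) ≤ 4 * passiveQueryComplexity ε (Pol n d) := by
    intro n d hn hd hdn
    exact_mod_cast hn₀ n d hn hd hdn
  refine ⟨⟨1 / 4, K + 1, n₀, by norm_num, by positivity, fun n d hn hd hdn => ⟨?_, ?_⟩⟩,
    fun d => ⟨isTheta_numMonomials d, ?_⟩⟩
  · linarith [hlower n d hn hd hdn]
  · refine (hupper n d).trans ?_
    gcongr
    linarith
  · refine Asymptotics.IsTheta.trans ?_ (isTheta_numMonomials d)
    constructor
    · refine Asymptotics.IsBigO.of_bound K (Eventually.of_forall fun n => ?_)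
      rw [Real.norm_natCast, Real.norm_natCast]
      exact hupper n d
    · refine Asymptotics.IsBigO.of_bound 4 ?_
      rcases Nat.eq_zero_or_pos d with rfl | hd
      · obtain ⟨n₁, hn₁⟩ := eventually_one_le_passiveQueryComplexity hε₀ hε₁
        filter_upwards [eventually_ge_atTop n₁] with n hn
        have h1 : (1 : ℝ) ≤ passiveQueryComplexity ε (Pol n 0) := by exact_mod_cast hn₁ n hn
        rw [Real.norm_natCast, Real.norm_natCast]
        simp only [numMonomials, zero_add, Finset.range_one, Finset.sum_singleton,
          Nat.choose_zero_right, Nat.cast_one]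
        linarith
      · have hev : ∀ᶠ n : ℕ in atTop, (d : ℝ) ≤ (n : ℝ) ^ ((1 : ℝ) / 3) :=
          tendsto_natCast_atTop_atTop.eventually
            ((tendsto_rpow_atTop (by norm_num : (0 : ℝ) < 1 / 3)).eventually_ge_atTop (d : ℝ))
        filter_upwards [eventually_ge_atTop n₀, hev] with n hn hdn
        rw [Real.norm_natCast, Real.norm_natCast]
        exact hlower n d hn hd hdn
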